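/- **Algorithm.** Let $\mathbb I$ be any set of process identifiers and $\mathbb P$ any set of payloads. The processes exchange packets $\mathrm{msg}(m)$, $\mathrm{ack}(n)$, $\mathrm{permit}(n)$, where $n\in\mathbb N$ and a message $m$ has a receiver $m.rcv$, an id $m.mid\in\mathbb N$, the id $m.pid$ of its predecessor from the same sender to the same receiver ($0$ if there is none), a permit field $m.per$ and a payload $m.pl$. Process $i$ keeps: a clock $ck$, initially $1$; maps $ls, ld:\mathbb I\to\mathbb N$ (last sent and last delivered ids), initially $0$ everywhere; a FIFO send buffer $sb$, initially empty; for each sender $j$ a receive buffer $rb[j]$, a finite map from predecessor ids to received messages, initially empty; the unacked buffer $u$, an array that grows at its end and shrinks at its start, occupying the indices $u.first,\dots,u.next-1$, initially empty with $u.first=u.next=1$; and the missing-permit map $p$, a set of pairs (sender, message id), each of which got the index $p.next$ when it was added, $p.next$ then being incremented; initially $p$ is empty and $p.next=0$; $p.first$ is the smallest index of a pair still present, or $p.next$ if there is none. Each of the following handlers of $i$ runs atomically. * *trySend*: while $sb$ is non-empty, let $m$ be its oldest message; if $p.first<m.per$, stop; otherwise remove $m$ from $sb$, set $m.per$ to the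 truth value of "$u$ is non-empty", append $m$ to $u$, and network-send $\mathrm{msg}(m)$ to $m.rcv$. * *causal-send* of a payload $x$ to $j$: append to $sb$ the message with receiver $j$, id $ck$, predecessor $ls[j]$, permit index $p.next$ and payload $x$; set $ls[j]:=ck$; increment $ck$; run trySend. * *receive* $\mathrm{msg}(m)$ from $j$: if $m.mid\le ld[j]$, send $\mathrm{ack}(m.mid)$ to $j$ and stop. Otherwise store $m$ in $rb[j]$ under the key $m.pid$; then, while $ld[j]$ is a key of $rb[j]$, remove the message $b$ stored under that key, set $ld[j]:=b.mid$, add $(j,b.mid)$ to $p$ if $b.per$ is true, send $\mathrm{ack}(b.mid)$ to $j$, and deliver $b$. * *receive* $\mathrm{ack}(n)$ from $j$: if $n<u.first$, send $\mathrm{permit}(n)$ to $j$ and stop. Otherwise set the payload of $u[n]$ to $\bot$. If $n=u.first$, remove the first entry of $u$; then, while $u$ is non-empty, let $m$ be its first entry; if $m.per$ is true, send $\mathrm{permit}(m.mid)$ to $m.rcv$; if $m.pl\ne\bot$, stop; otherwise remove $m$ from $u$. * *receive* $\mathrm{permit}(n)$ from $j$: remove $(j,n)$ from $p$ if present; run trySend.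 * *periodic action*: send $\mathrm{msg}(m)$ to $m.rcv$ for each $m$ in $u$ with $m.pl\neq\bot$, and $\mathrm{ack}(n)$ to $j$ for each $(j,n)$ in $p$. **Executions.** An execution is an infinite sequence of events (causal-send, receipt of a packet, periodic action), each at one process, starting from the initial states. Causal-sends are arbitrary. A process may receive a packet from another one only if that packet was sent earlier by that process to it; there is no bound on delays, and packets may be lost, duplicated and reordered. Assume that * every process at which some event occurs performs its periodic action infinitely often (processes do not fail), and * the network is fair: if a process $i$ sends one and the same packet to a process $j$ infinitely often, then $j$ receives that packet from $i$ infinitely often. **Proposition.** In every such execution, every causal-sent message eventually leaves the send buffer and is eventually delivered at its destination: whenever process $i$ causal-sends a payload $x$ to process $j$, creating a message with id $n$, there is a step, not before that of the causal-send, at which $i$ network-sends to $j$ the message with id $n$ and payload $x$, after which no message with id $n$ is ever in the send buffer of $i$; and at some later step $j$ delivers the message from $i$ with id $n$ and payload $x$. -/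

import Mathlib

namespace CausalDelivery

universe u v w

/-! ### Sliding array and sliding map -/

/-- A sliding array: the elements at the indices `first, first + 1, …, next - 1`. -/
structure SlidingArray (α : Type u) where
  first : ℕ
  elems : List α

namespace SlidingArray

variable {α : Type u}

def size (a : SlidingArray α) : ℕ := a.elems.length

def add (a : SlidingArray α) (x : α) : SlidingArray α :=
  { a with elems := a.elems ++ [x] }

/-- Update in place the element at index `n` (where `first ≤ n < next`). -/
def modifyAt (a : SlidingArray α) (n : ℕ) (f : α → α) : SlidingArray α :=
  { a with elems := a.elems.modify (n - a.first) f }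

/-- Remove the oldest element. -/
def remove (a : SlidingArray α) : SlidingArray α :=
  { first := a.first + 1, elems := a.elems.tail }

end SlidingArray

/-- A sliding map: the elements that are present, each with its index, in increasing order of the
indices, and the index `next` that the next added element gets. -/
structure SlidingMap (α : Type u) where
  next : ℕ
  entries : List (ℕ × α)

namespace SlidingMap

variable {α : Type u}

def add (p : SlidingMap α) (x : α) : SlidingMap α :=
  { next := p.next + 1, entries := p.entries ++ [(p.next, x)] }

/-- Removal by key; no effect if the key is absent. -/
def remove [DecidableEq α] (p : SlidingMap α) (x : α) : SlidingMap α :=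
  { p with entries := p.entries.filter (fun e => e.2 ≠ x) }

/-- The index of the oldest element that is present, or `next` if there is none. -/
def first (p : SlidingMap α) : ℕ :=
  match p.entries with
  | [] => p.next
  | e :: _ => e.1

end SlidingMap

/-! ### Records -/

/-- Message record: receiver, message id, id of the predecessor from the same sender to the same
receiver (`0` if there is none), permit field, payload. -/
structure Msg (I : Type u) (κ : Type v) (π : Type w) where
  rcv : I
  mid : ℕ
  pid : ℕ
  per : κ
  pl : π

/-- A message in the send buffer: the permit field is a permit index. -/
abbrev QueuedMsg (I : Type u) (P : Type v) := Msg I ℕ P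

/-- A message in the unacked buffer: the permit field says whether a permit is needed; the payload
is `none` once the message has been acked. -/
abbrev UnackedMsg (I : Type u) (P : Type v) := Msg I Bool (Option P)

/-- A message in transit. -/
abbrev WireMsg (I : Type u) (P : Type v) := Msg I Bool P

/-- Permit record. -/
structure Per (I : Type u) where
  snd : I
  mid : ℕ
  deriving DecidableEq

/-- Receive buffer record. -/
structure Rcv (P : Type v) where
  mid : ℕ
  pl : P
  per : Bool

/-- What the network carries. -/
inductive Packet (I : Type u) (P : Type v) where
  | msg (m : WireMsg I P)
  | ack (n : ℕ)
  | permit (n : ℕ)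

/-- A delivery to the application: sender, id and payload of the delivered message. -/
structure Delivery (I : Type u) (P : Type v) where
  src : I
  mid : ℕ
  pl : P

/-! ### State of a process -/

/-- State of a process. Partial maps into `ℕ` are total functions, with value `0` at the keys that
are not mapped. Message ids start at `1`, so that `0` is not a message id. -/
structure ProcState (I : Type u) (P : Type v) where
  /-- clock for message ids -/
  ck : ℕ
  /-- unacked messages -/
  u : SlidingArray (UnackedMsg I P)
  /-- missing permits -/
  p : SlidingMap (Per I)
  /-- last sent message ids -/
  ls : I → ℕ
  /-- last delivered message ids -/
  ld : I → ℕ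
  /-- send buffer, oldest message first -/
  sb : List (QueuedMsg I P)
  /-- receive buffer: for each sender, a finite map from predecessor ids to records -/
  rb : I → AList (fun _ : ℕ => Rcv P)

def ProcState.init (I : Type u) (P : Type v) : ProcState I P where
  ck := 1
  u := { first := 1, elems := [] }
  p := { next := 0, entries := [] }
  ls := fun _ => 0
  ld := fun _ => 0
  sb := []
  rb := fun _ => ∅

/-- Outcome of a handler: the new state, the packets sent over the network (each with its
destination), and the messages delivered to the application. -/
structure Outcome (I : Type u) (P : Type v) where
  state : ProcState I P
  sends : List (I × Packet I P)
  delivered : List (Delivery I P)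

variable {I : Type u} {P : Type v}

/-! ### The handlers of the basic algorithm -/

/-- The loop of `trySend`, on the permits map, the send buffer and the unacked buffer. It returns
the two new buffers and the packets sent. -/
def trySendLoop (p : SlidingMap (Per I)) :
    List (QueuedMsg I P) → SlidingArray (UnackedMsg I P) →
      List (QueuedMsg I P) × SlidingArray (UnackedMsg I P) × List (I × Packet I P)
  | [], ub => ([], ub, [])
  | m :: sb, ub =>
    if p.first < m.per then (m :: sb, ub, [])
    else
      let flag : Bool := decide (0 < ub.size)
      let r := trySendLoop p sb (ub.add ⟨m.rcv, m.mid, m.pid, flag, some m.pl⟩)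
      (r.1, r.2.1, (m.rcv, .msg ⟨m.rcv, m.mid, m.pid, flag, m.pl⟩) :: r.2.2)

/-- The procedure `trySend`. -/
def trySend (s : ProcState I P) : Outcome I P :=
  let r := trySendLoop s.p s.sb s.u
  { state := { s with sb := r.1, u := r.2.1 }, sends := r.2.2, delivered := [] }

/-- `causalSend` of payload `x` to `j`. -/
def onCausalSend [DecidableEq I] (s : ProcState I P) (j : I) (x : P) : Outcome I P :=
  trySend
    { s with
      ls := Function.update s.ls j s.ck
      ck := s.ck + 1
      sb := s.sb ++ [⟨j, s.ck, s.ls j, s.p.next, x⟩] }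

theorem length_erase_lt {e : AList (fun _ : ℕ => Rcv P)} {k : ℕ} {b : Rcv P}
    (h : e.lookup k = some b) : (e.erase k).keys.length < e.keys.length := by
  have hk : k ∈ e.keys := AList.mem_keys.1 (AList.lookup_isSome.1 (by simp [h]))
  rw [AList.keys_erase, List.length_erase_of_mem hk]
  have := List.length_pos_of_mem hk
  omega

/-- Result of the delivery loop. -/
structure DeliverResult (I : Type u) (P : Type v) where
  e : AList (fun _ : ℕ => Rcv P)
  ld : ℕ
  p : SlidingMap (Per I)
  sends : List (I × Packet I P)
  delivered : List (Delivery I P)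

/-- The delivery loop for messages from `j`: while the last delivered id `ld` is a key of the
receive buffer `e` for `j`, remove and deliver the record stored under it. -/
def deliverLoop (j : I) (e : AList (fun _ : ℕ => Rcv P)) (ld : ℕ) (p : SlidingMap (Per I)) :
    DeliverResult I P :=
  match _h : e.lookup ld with
  | none => ⟨e, ld, p, [], []⟩
  | some b =>
    let r := deliverLoop j (e.erase ld) b.mid (if b.per then p.add ⟨j, b.mid⟩ else p)
    { r with
      sends := (j, .ack b.mid) :: r.sends
      delivered := ⟨j, b.mid, b.pl⟩ :: r.delivered }
termination_by e.keys.length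
decreasing_by exact length_erase_lt _h

/-- Receiving the message `m` from `j`. -/
def onMsg [DecidableEq I] (s : ProcState I P) (j : I) (m : WireMsg I P) : Outcome I P :=
  if m.mid ≤ s.ld j then ⟨s, [(j, .ack m.mid)], []⟩
  else
    let r := deliverLoop j ((s.rb j).insert m.pid ⟨m.mid, m.pl, m.per⟩) (s.ld j) s.p
    { state :=
        { s with
          rb := Function.update s.rb j r.e
          ld := Function.update s.ld j r.ld
          p := r.p }
      sends := r.sends
      delivered := r.delivered }

/-- The loop run after the oldest unacked message has been acked and removed; the arguments are the
current first index and the elements of the unacked buffer. -/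
def permitLoop : ℕ → List (UnackedMsg I P) → SlidingArray (UnackedMsg I P) × List (I × Packet I P)
  | f, [] => (⟨f, []⟩, [])
  | f, m :: l =>
    let out : List (I × Packet I P) := if m.per then [(m.rcv, .permit m.mid)] else []
    match m.pl with
    | some _ => (⟨f, m :: l⟩, out)
    | none =>
      let r := permitLoop (f + 1) l
      (r.1, out ++ r.2)

/-- Receiving from `j` the ack of message `n`. -/
def onAck (s : ProcState I P) (j : I) (n : ℕ) : Outcome I P :=
  if n < s.u.first then ⟨s, [(j, .permit n)], []⟩
  else
    let ub := s.u.modifyAt n (fun m => { m with pl := none })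
    if n = ub.first then
      let r := permitLoop ub.remove.first ub.remove.elems
      ⟨{ s with u := r.1 }, r.2, []⟩
    else ⟨{ s with u := ub }, [], []⟩

/-- Receiving from `j` the permit for message `n`. -/
def onPermit [DecidableEq I] (s : ProcState I P) (j : I) (n : ℕ) : Outcome I P :=
  trySend { s with p := s.p.remove ⟨j, n⟩ }

/-- The periodic action: retransmit the unacked messages, and ack again the messages whose permit is
missing. -/
def onPeriodic (s : ProcState I P) : Outcome I P where
  state := s
  sends :=
    s.u.elems.filterMap (fun m =>
      m.pl.map (fun x => (m.rcv, Packet.msg ⟨m.rcv, m.mid, m.pid, m.per, x⟩))) ++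
    s.p.entries.map (fun e => (e.2.snd, Packet.ack e.2.mid))
  delivered := []

/-! ### The distributed system -/

/-- A packet sent by `src` to `dst`. -/
structure Sent (I : Type u) (P : Type v) where
  src : I
  dst : I
  body : Packet I P

/-- A global configuration: the local states, and the set of all packets sent so far. -/
structure Config (I : Type u) (P : Type v) where
  proc : I → ProcState I P
  net : Set (Sent I P)

def Config.init (I : Type u) (P : Type v) : Config I P where
  proc := fun _ => ProcState.init I P
  net := ∅

inductive Event (I : Type u) (P : Type v) where
  /-- the application at `i` causal-sends payload `x` to `j` -/
  | causalSend (i j : I) (x : P)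
  /-- process `i` receives a packet from process `j` -/
  | receive (i j : I) (k : Packet I P)
  /-- the periodic action of process `i` -/
  | periodic (i : I)

/-- The process at which an event takes place. -/
def Event.proc : Event I P → I
  | .causalSend i _ _ => i
  | .receive i _ _ => i
  | .periodic i => i

/-- Only packets that have been sent can be received. A packet may be received late, out of order,
several times, or never. -/
def Event.Enabled (c : Config I P) : Event I P → Prop
  | .receive i j k => (⟨j, i, k⟩ : Sent I P) ∈ c.net
  | _ => True

/-- The handler that an event triggers. -/
def Event.handle [DecidableEq I] (s : ProcState I P) : Event I P → Outcome I P
  | .causalSend _ j x => onCausalSend s j x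
  | .receive _ j (.msg m) => onMsg s j m
  | .receive _ j (.ack n) => onAck s j n
  | .receive _ j (.permit n) => onPermit s j n
  | .periodic _ => onPeriodic s

/-- Every process that takes part in the execution performs its periodic action again and again. -/
def PeriodicFair (ev : ℕ → Event I P) : Prop :=
  ∀ i, (∃ t, (ev t).proc = i) → ∀ t, ∃ s ≥ t, ev s = .periodic i

variable [DecidableEq I]

/-- What the event `e` does at its process in configuration `c`. -/
def Config.outcome (c : Config I P) (e : Event I P) : Outcome I P :=
  e.handle (c.proc e.proc)

/-- The packets sent by the event `e` in configuration `c`. -/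
def Config.sentBy (c : Config I P) (e : Event I P) : Set (Sent I P) :=
  {w | w.src = e.proc ∧ (w.dst, w.body) ∈ (c.outcome e).sends}

/-- The configuration after the event `e`. -/
def Config.step (c : Config I P) (e : Event I P) : Config I P where
  proc := Function.update c.proc e.proc (c.outcome e).state
  net := c.net ∪ c.sentBy e

/-- `cfg` and `ev` form an (infinite) execution of the basic algorithm: `cfg 0` is initial, and the
event `ev t` leads from `cfg t` to `cfg (t + 1)`. -/
structure IsExecution (cfg : ℕ → Config I P) (ev : ℕ → Event I P) : Prop where
  init : cfg 0 = Config.init I P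
  enabled : ∀ t, (ev t).Enabled (cfg t)
  step : ∀ t, cfg (t + 1) = (cfg t).step (ev t)

/-- Fair lossy network: a packet that a process sends to another one infinitely often is received
there infinitely often. -/
def FairLossy (cfg : ℕ → Config I P) (ev : ℕ → Event I P) : Prop :=
  ∀ (i j : I) (k : Packet I P),
    (∀ t, ∃ s ≥ t, (⟨i, j, k⟩ : Sent I P) ∈ (cfg s).sentBy (ev s)) →
      ∀ t, ∃ s ≥ t, ev s = .receive j i k

/-- At step `t`, process `i` network-sends to `j` its message with id `n` and payload `x`. -/
def NetworkSends (cfg : ℕ → Config I P) (ev : ℕ → Event I P) (t : ℕ) (i j : I) (n : ℕ) (x : P) :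
    Prop :=
  ∃ m : WireMsg I P, m.mid = n ∧ m.pl = x ∧
    (⟨i, j, .msg m⟩ : Sent I P) ∈ (cfg t).sentBy (ev t)

/-- At step `t`, process `j` delivers the message with id `n` and payload `x` sent by `i`. -/
def Delivers (cfg : ℕ → Config I P) (ev : ℕ → Event I P) (t : ℕ) (j i : I) (n : ℕ) (x : P) :
    Prop :=
  (ev t).proc = j ∧ (⟨i, n, x⟩ : Delivery I P) ∈ ((cfg t).outcome (ev t)).delivered

end CausalDelivery

/-!
Whatever a process waits for is asked for again and again, and what is sent infinitely often is
received infinitely often. That network-sent messages get delivered and acked does not depend on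
permits, and that permits arrive depends only on acks, so the waiting is not circular. It does not
matter for liveness which messages carry the permit flag.

*Safety.* Fix the causal-sent messages (`Created`); an id determines its message, and the messages
from `i` to `j` form a chain without gaps through their predecessor ids. The invariant (`Invariant`,
`invariant`) says that all buffers and packets hold such messages only, that the ids in the unacked
buffer and then the send buffer of a process are consecutive, that `ack n` is sent only when the
message `n` has been delivered, and that a network-sent message that has not been delivered is in
the unacked buffer with its payload. Moreover the oldest unacked message has never been acked, and
the oldest message of the send buffer waits for a permit that is missing.

*Liveness.* A network-sent message that is not acked is retransmitted, hence received, infinitely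
often; by induction on ids its predecessor is delivered at some time, and a later receipt delivers
the message (`exists_le_ld`). From then on every receipt is answered by an ack, so that no message
stays unacked (`not_eventually_unacked`), and as the oldest unacked message has not been acked, the
start of the unacked buffer passes every network-sent id (`exists_lt_first`). Then every repeated
ack for a missing permit is answered by the permit, so no permit stays missing
(`not_eventually_missing`). A queued message waits only for permits that were missing when it was
queued, and those are finitely many; so the send buffer always advances (`exists_lt_uNext`). A
message thus leaves the send buffer, by being network-sent (`exists_sent_of_uNext`), and is
delivered at the step at which the id of the last delivered message reaches its id
(`delivers_of_ld`).
-/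

namespace CausalDelivery

variable {I P : Type*}

/-! ### What the handlers do to the state of a process -/

/-- The index after the last one of the unacked buffer; in an execution, the messages with smaller
ids are those that have been sent over the network. -/
def ProcState.uNext (s : ProcState I P) : ℕ := s.u.first + s.u.elems.length

/-- The entry of the unacked buffer for the queued message `m`, with permit flag `b`. -/
def Msg.toUnacked (m : QueuedMsg I P) (b : Bool) : UnackedMsg I P :=
  ⟨m.rcv, m.mid, m.pid, b, some m.pl⟩

/-- The message in transit for the queued message `m`, with permit flag `b`. -/
def Msg.toWire (m : QueuedMsg I P) (b : Bool) : WireMsg I P :=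
  ⟨m.rcv, m.mid, m.pid, b, m.pl⟩

/-- The messages moved by the loop of `trySend`, each with its permit flag, are a prefix `vs` of the
send buffer. -/
theorem trySendLoop_spec (p : SlidingMap (Per I)) (sb : List (QueuedMsg I P))
    (ub : SlidingArray (UnackedMsg I P)) :
    ∃ vs : List (QueuedMsg I P × Bool),
      sb = vs.map Prod.fst ++ (trySendLoop p sb ub).1 ∧
      (trySendLoop p sb ub).2.1 = ⟨ub.first, ub.elems ++ vs.map fun v => v.1.toUnacked v.2⟩ ∧
      (trySendLoop p sb ub).2.2 = vs.map (fun v => (v.1.rcv, Packet.msg (v.1.toWire v.2))) ∧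
      ∀ m ∈ (trySendLoop p sb ub).1.head?, p.first < m.per := by
  induction sb generalizing ub with
  | nil => exact ⟨[], by simp [trySendLoop]⟩
  | cons m sb ih =>
    rw [trySendLoop]
    split_ifs with h
    · exact ⟨[], by simpa using h⟩
    · obtain ⟨vs, h1, h2, h3, h4⟩ :=
        ih (ub.add ⟨m.rcv, m.mid, m.pid, decide (0 < ub.size), some m.pl⟩)
      refine ⟨(m, decide (0 < ub.size)) :: vs, ?_, ?_, ?_, h4⟩
      · simpa using h1
      · rw [h2]
        simp [SlidingArray.add, Msg.toUnacked]
      · simp [h3, Msg.toWire]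

theorem trySend_spec (s : ProcState I P) :
    ∃ (vs : List (QueuedMsg I P × Bool)) (sb' : List (QueuedMsg I P)),
      trySend s =
        ⟨{ s with
            sb := sb'
            u := ⟨s.u.first, s.u.elems ++ vs.map fun v => v.1.toUnacked v.2⟩ },
          vs.map (fun v => (v.1.rcv, Packet.msg (v.1.toWire v.2))), []⟩ ∧
      s.sb = vs.map Prod.fst ++ sb' ∧ ∀ m ∈ sb'.head?, s.p.first < m.per := by
  obtain ⟨vs, h1, h2, h3, h4⟩ := trySendLoop_spec s.p s.sb s.u
  exact ⟨vs, _, by simp only [trySend, h2, h3], h1, h4⟩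

theorem mem_sb_trySend {s : ProcState I P} {m : QueuedMsg I P} (h : m ∈ (trySend s).state.sb) :
    m ∈ s.sb := by
  obtain ⟨vs, sb', he, hsb, -⟩ := trySend_spec s
  rw [he] at h
  rw [hsb]
  exact List.mem_append_right _ h

/-- The loop removes a prefix `d` of acked messages and sends nothing but permits. -/
theorem permitLoop_spec (f : ℕ) (l : List (UnackedMsg I P)) :
    ∃ d : List (UnackedMsg I P),
      l = d ++ (permitLoop f l).1.elems ∧ (permitLoop f l).1.first = f + d.length ∧
      (∀ m ∈ d, m.pl = none) ∧ (∀ m ∈ (permitLoop f l).1.elems.head?, m.pl ≠ none) ∧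
      ∀ w ∈ (permitLoop f l).2, ∃ n, w.2 = Packet.permit n := by
  induction l generalizing f with
  | nil => exact ⟨[], by simp [permitLoop]⟩
  | cons m l ih =>
    rw [permitLoop]
    have hout : ∀ w ∈ (if m.per then [(m.rcv, Packet.permit m.mid)] else [] :
        List (I × Packet I P)), ∃ n, w.2 = Packet.permit n := by
      intro w hw
      split_ifs at hw
      · simp only [List.mem_singleton] at hw
        exact ⟨m.mid, by rw [hw]⟩
      · simp at hw
    split
    · next x hx => exact ⟨[], by simp, by simp, by simp, by simp [hx], hout⟩
    · next hx =>
      obtain ⟨d, h1, h2, h3, h4, h5⟩ := ih (f + 1)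
      refine ⟨m :: d, by simpa using h1, by simp [h2]; omega, by simpa [hx] using h3, h4, ?_⟩
      intro w hw
      rcases List.mem_append.1 hw with hw | hw
      · exact hout w hw
      · exact h5 w hw

/-- The local part of the invariant: the ids in the unacked buffer and the send buffer are
consecutive and end just before the clock, the oldest unacked message has not been acked, and the
oldest message of the send buffer still waits for a permit. -/
structure ProcState.WellFormed (s : ProcState I P) : Prop where
  first_le : s.u.first ≤ s.ck
  ids : s.u.elems.map Msg.mid ++ s.sb.map Msg.mid = List.range' s.u.first (s.ck - s.u.first)
  head : ∀ m ∈ s.u.elems.head?, m.pl ≠ none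
  blocked : ∀ m ∈ s.sb.head?, s.p.first < m.per

section Ids

variable {s : ProcState I P} (hle : s.u.first ≤ s.ck)
  (hids : s.u.elems.map Msg.mid ++ s.sb.map Msg.mid = List.range' s.u.first (s.ck - s.u.first))

include hle hids in
theorem uNext_add_length : s.uNext + s.sb.length = s.ck := by
  have := congrArg List.length hids
  simp only [List.length_append, List.length_map, List.length_range'] at this
  unfold ProcState.uNext
  omega

include hids in
theorem mid_of_getElem?_u {k : ℕ} {m : UnackedMsg I P} (h : s.u.elems[k]? = some m) :
    m.mid = s.u.first + k := by
  have hk : k < s.u.elems.length := (List.getElem?_eq_some_iff.1 h).1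
  have h1 := congrArg (·[k]?) hids
  rw [List.getElem?_append_left (by simpa using hk), List.getElem?_map, h, Option.map_some] at h1
  obtain ⟨h2, h3⟩ := List.getElem?_eq_some_iff.1 h1.symm
  simpa using h3.symm

include hids in
theorem mid_of_getElem?_sb {k : ℕ} {m : QueuedMsg I P} (h : s.sb[k]? = some m) :
    m.mid = s.uNext + k := by
  have h1 := congrArg (·[s.u.elems.length + k]?) hids
  rw [List.getElem?_append_right (by simp), List.getElem?_map, List.length_map,
    Nat.add_sub_cancel_left, h, Option.map_some] at h1
  obtain ⟨h2, h3⟩ := List.getElem?_eq_some_iff.1 h1.symm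
  simp only [List.getElem_range', one_mul] at h3
  unfold ProcState.uNext
  omega

include hids in
theorem mid_lt_uNext {m : UnackedMsg I P} (h : m ∈ s.u.elems) :
    s.u.first ≤ m.mid ∧ m.mid < s.uNext := by
  obtain ⟨k, hk⟩ := List.mem_iff_getElem?.1 h
  have h1 := mid_of_getElem?_u hids hk
  have := (List.getElem?_eq_some_iff.1 hk).1
  unfold ProcState.uNext
  omega

include hids in
theorem uNext_le_mid {m : QueuedMsg I P} (h : m ∈ s.sb) : s.uNext ≤ m.mid := by
  obtain ⟨k, hk⟩ := List.mem_iff_getElem?.1 h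
  have := mid_of_getElem?_sb hids hk
  omega

end Ids

theorem ProcState.WellFormed.exists_oldest {s : ProcState I P} (hs : s.WellFormed)
    (hlt : s.u.first < s.uNext) :
    ∃ j pid b x, (⟨j, s.u.first, pid, b, some x⟩ : UnackedMsg I P) ∈ s.u.elems := by
  cases hu : s.u.elems with
  | nil => simp [ProcState.uNext, hu] at hlt
  | cons m l =>
    have hmid : m.mid = s.u.first := mid_of_getElem?_u hs.ids (k := 0) (by simp [hu])
    have hpl := hs.head m (by simp [hu])
    obtain ⟨j, n, pid, b, pl⟩ := m
    obtain ⟨x, rfl⟩ := Option.ne_none_iff_exists'.1 hpl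
    obtain rfl : n = s.u.first := hmid
    exact ⟨j, pid, b, x, List.mem_cons_self⟩

/-- Ids stay consecutive when a message is put into the send buffer under the current clock. -/
theorem ProcState.WellFormed.ids_push {s : ProcState I P} (hs : s.WellFormed) (j : I)
    (pid per : ℕ) (x : P) :
    s.u.elems.map Msg.mid ++ (s.sb ++ [(⟨j, s.ck, pid, per, x⟩ : QueuedMsg I P)]).map Msg.mid =
      List.range' s.u.first (s.ck + 1 - s.u.first) := by
  have hle := hs.first_le
  rw [List.map_append, ← List.append_assoc, hs.ids,
    show s.ck + 1 - s.u.first = s.ck - s.u.first + 1 by omega, List.range'_concat]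
  simp
  omega

/-- `trySend` network-sends every message whose id gets below the end of the unacked buffer. -/
theorem trySend_sent {s : ProcState I P}
    (hids : s.u.elems.map Msg.mid ++ s.sb.map Msg.mid = List.range' s.u.first (s.ck - s.u.first))
    {n : ℕ} (h1 : s.uNext ≤ n) (h2 : n < (trySend s).state.uNext) :
    ∃ m ∈ s.sb, ∃ b, m.mid = n ∧ m.toUnacked b ∈ (trySend s).state.u.elems ∧
      (m.rcv, Packet.msg (m.toWire b)) ∈ (trySend s).sends := by
  obtain ⟨vs, sb', he, hsb, -⟩ := trySend_spec s
  rw [he] at h2 ⊢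
  simp only [ProcState.uNext, List.length_append, List.length_map] at h1 h2
  obtain ⟨k, rfl⟩ := Nat.exists_eq_add_of_le h1
  have hk : k < vs.length := by omega
  have hv : vs[k] ∈ vs := List.getElem_mem hk
  have hm : s.sb[k]? = some vs[k].1 := by
    rw [hsb, List.getElem?_append_left (by simpa using hk)]
    simp [hk]
  refine ⟨vs[k].1, List.mem_of_getElem? hm, vs[k].2, mid_of_getElem?_sb hids hm, ?_, ?_⟩
  · exact List.mem_append_right _ (List.mem_map.2 ⟨_, hv, rfl⟩)
  · exact List.mem_map.2 ⟨_, hv, rfl⟩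

/-- Mark the unacked message `m` as acked if its id is `n`. -/
def ackIf (n : ℕ) (m : UnackedMsg I P) : UnackedMsg I P :=
  if m.mid = n then { m with pl := none } else m

theorem ackIf_mid (n : ℕ) (m : UnackedMsg I P) : (ackIf n m).mid = m.mid := by
  unfold ackIf; split_ifs <;> rfl

theorem ackIf_of_ne {n : ℕ} {m : UnackedMsg I P} (h : m.mid ≠ n) : ackIf n m = m := by
  simp [ackIf, h]

theorem ackIf_pl_of_eq {n : ℕ} {m : UnackedMsg I P} (h : m.mid = n) : (ackIf n m).pl = none := by
  simp [ackIf, h]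

theorem eq_of_ackIf_pl_eq_some {n : ℕ} {m : UnackedMsg I P} {x : P} (h : (ackIf n m).pl = some x) :
    ackIf n m = m := by
  by_cases hm : m.mid = n
  · simp [ackIf_pl_of_eq hm] at h
  · exact ackIf_of_ne hm

/-- Since ids are consecutive, updating in place at index `n` marks exactly the message `n`. -/
theorem modifyAt_eq_map {s : ProcState I P}
    (hids : s.u.elems.map Msg.mid ++ s.sb.map Msg.mid = List.range' s.u.first (s.ck - s.u.first))
    {n : ℕ} (hn : s.u.first ≤ n) :
    s.u.modifyAt n (fun m => { m with pl := none }) = ⟨s.u.first, s.u.elems.map (ackIf n)⟩ := by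
  unfold SlidingArray.modifyAt
  congr 1
  apply List.ext_getElem?
  intro k
  rw [List.getElem?_modify, List.getElem?_map]
  cases hk : s.u.elems[k]? with
  | none => simp
  | some m =>
    have := mid_of_getElem?_u hids hk
    by_cases h : m.mid = n
    · simp [ackIf, h, show n - s.u.first = k by omega]
    · simp [ackIf, h, show n - s.u.first ≠ k by omega]

/-- On an ack of a sent message `n`, that message is marked as acked, and then a prefix of acked
messages is removed from the unacked buffer. -/
theorem onAck_spec {s : ProcState I P} (hs : s.WellFormed) (j : I) {n : ℕ} (hn : n < s.uNext) :
    ∃ (u' : SlidingArray (UnackedMsg I P)) (d : List (UnackedMsg I P)),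
      (onAck s j n).state = { s with u := u' } ∧
      s.u.elems.map (ackIf n) = d ++ u'.elems ∧ u'.first = s.u.first + d.length ∧
      (∀ m ∈ d, m.pl = none) ∧ (∀ m ∈ u'.elems.head?, m.pl ≠ none) ∧
      (onAck s j n).delivered = [] ∧
      ∀ w ∈ (onAck s j n).sends, ∃ k, w.2 = Packet.permit k := by
  have hids := hs.ids
  by_cases h1 : n < s.u.first
  · refine ⟨s.u, [], by simp [onAck, h1], ?_, by simp, by simp, hs.head, by simp [onAck, h1],
      by simp [onAck, h1]⟩
    rw [List.nil_append]
    refine (List.map_congr_left fun m hm => ackIf_of_ne ?_).trans (List.map_id _)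
    have := (mid_lt_uNext hids hm).1
    omega
  · have hm := modifyAt_eq_map hids (not_lt.1 h1)
    by_cases h2 : n = s.u.first
    · obtain ⟨m, l, hl⟩ : ∃ m l, s.u.elems = m :: l := by
        cases h : s.u.elems with
        | nil => simp [ProcState.uNext, h] at hn; omega
        | cons m l => exact ⟨m, l, rfl⟩
      have hmid : m.mid = n := by
        rw [h2]; exact mid_of_getElem?_u hids (k := 0) (by simp [hl])
      obtain ⟨d, g1, g2, g3, g4, g5⟩ := permitLoop_spec (s.u.first + 1) (l.map (ackIf n))
      have he : onAck s j n = ⟨{ s with u := (permitLoop (s.u.first + 1) (l.map (ackIf n))).1 },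
          (permitLoop (s.u.first + 1) (l.map (ackIf n))).2, []⟩ := by
        unfold onAck
        rw [if_neg h1, hm]
        simp [h2, SlidingArray.remove, hl]
      rw [he]
      refine ⟨_, ackIf n m :: d, rfl, by simp [hl, ← g1], by simp [g2]; omega, ?_, g4, rfl, g5⟩
      simpa [ackIf_pl_of_eq hmid] using g3
    · have he : onAck s j n = ⟨{ s with u := ⟨s.u.first, s.u.elems.map (ackIf n)⟩ }, [], []⟩ := by
        unfold onAck
        rw [if_neg h1, hm]
        simp [h2]
      rw [he]
      refine ⟨_, [], rfl, by simp, by simp, by simp, ?_, rfl, by simp⟩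
      intro m hm'
      cases h : s.u.elems with
      | nil => simp [h] at hm'
      | cons m' l =>
        have hmid : m'.mid = s.u.first := mid_of_getElem?_u hids (k := 0) (by simp [h])
        simp only [h, List.map_cons, List.head?_cons, Option.mem_def, Option.some.injEq] at hm'
        rw [← hm', ackIf_of_ne (by omega)]
        exact hs.head m' (by simp [h])

/-- What the delivery loop guarantees when every record of the receive buffer is related by `R` to
its key. By `delivered`, the id of the last delivered message advances only along records that are
delivered; by `first_eq`, adding missing permits never changes the index of the oldest one. -/
structure DeliverSpec (j : I) (R : ℕ → Rcv P → Prop) (e : AList (fun _ : ℕ => Rcv P)) (ld : ℕ)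
    (p : SlidingMap (Per I)) (r : DeliverResult I P) : Prop where
  rb : ∀ k b, r.e.lookup k = some b → R k b
  ld_le : ld ≤ r.ld
  ld_eq : r.ld = ld ∨ ∃ k b, R k b ∧ b.mid = r.ld
  sends : ∀ w ∈ r.sends, ∃ k b, R k b ∧ w = (j, Packet.ack b.mid) ∧ b.mid ≤ r.ld
  entries : ∀ q ∈ r.p.entries, q ∈ p.entries ∨
    p.next ≤ q.1 ∧ ∃ k b, R k b ∧ q.2 = ⟨j, b.mid⟩ ∧ b.mid ≤ r.ld
  next_le : p.next ≤ r.p.next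
  first_eq : r.p.first = p.first
  delivered : ∀ n, ld < n → n ≤ r.ld →
    ∃ k b, R k b ∧ k < n ∧ n ≤ b.mid ∧ (⟨j, b.mid, b.pl⟩ : Delivery I P) ∈ r.delivered
  progress : ∀ b, e.lookup ld = some b → b.mid ≤ r.ld

theorem SlidingMap.first_add {α : Type*} (p : SlidingMap α) (x : α) :
    (p.add x).first = p.first := by
  unfold SlidingMap.first SlidingMap.add
  cases p.entries <;> rfl

theorem deliverLoop_spec (j : I) {R : ℕ → Rcv P → Prop} (hR : ∀ k b, R k b → k < b.mid)
    (e : AList (fun _ : ℕ => Rcv P)) (ld : ℕ) (p : SlidingMap (Per I))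
    (he : ∀ k b, e.lookup k = some b → R k b) :
    DeliverSpec j R e ld p (deliverLoop j e ld p) := by
  induction e, ld, p using deliverLoop.induct j with
  | case1 e ld p h =>
    rw [deliverLoop]
    split
    · exact ⟨he, le_rfl, Or.inl rfl, by simp, fun q hq => Or.inl hq, le_rfl, rfl,
        fun n h1 h2 => absurd h1 h2.not_gt, by simp [h]⟩
    · simp_all
  | case2 e ld p b h ih =>
    rw [deliverLoop]
    split
    · simp_all
    · next b' h' =>
      obtain rfl : b = b' := by simpa [h] using h'
      have hb := he _ _ h
      have hlt := hR _ _ hb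
      specialize ih fun k c hk => by
        by_cases hkl : k = ld
        · subst hkl; simp at hk
        · exact he k c (by rwa [AList.lookup_erase_ne hkl] at hk)
      have hp : p.next ≤ (if b.per then p.add ⟨j, b.mid⟩ else p).next := by
        split_ifs <;> simp [SlidingMap.add]
      refine ⟨ih.rb, hlt.le.trans ih.ld_le, ?_, ?_, ?_, hp.trans ih.next_le, ?_, ?_, ?_⟩
      · rcases ih.ld_eq with h1 | h1
        · exact Or.inr ⟨_, b, hb, h1.symm⟩
        · exact Or.inr h1
      · intro w hw
        rcases List.mem_cons.1 hw with rfl | hw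
        · exact ⟨_, b, hb, rfl, ih.ld_le⟩
        · exact ih.sends w hw
      · intro q hq
        rcases ih.entries q hq with h1 | ⟨h1, h2⟩
        · split_ifs at h1
          · simp only [SlidingMap.add, List.mem_append, List.mem_singleton] at h1
            rcases h1 with h1 | rfl
            · exact Or.inl h1
            · exact Or.inr ⟨le_rfl, _, b, hb, rfl, ih.ld_le⟩
          · exact Or.inl h1
        · exact Or.inr ⟨hp.trans h1, h2⟩
      · refine ih.first_eq.trans ?_
        split_ifs
        · exact SlidingMap.first_add _ _
        · rfl
      · intro n h1 h2
        by_cases hn : n ≤ b.mid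
        · exact ⟨_, b, hb, h1, hn, by simp⟩
        · obtain ⟨k, c, g1, g2, g3, g4⟩ := ih.delivered n (not_le.1 hn) h2
          exact ⟨k, c, g1, g2, g3, List.mem_cons_of_mem _ g4⟩
      · intro c hc
        obtain rfl : b = c := by simpa [h] using hc
        exact ih.ld_le

/-- How the state of a process changes in the course of an execution: the ends of the unacked buffer
and the ids of the last delivered messages only grow, and missing permits that are added get new
indices. -/
structure ProcState.Evolves (s s' : ProcState I P) : Prop where
  uNext_le : s.uNext ≤ s'.uNext
  first_le : s.u.first ≤ s'.u.first
  ld_le : ∀ i, s.ld i ≤ s'.ld i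
  next_le : s.p.next ≤ s'.p.next
  entries : ∀ e ∈ s'.p.entries, e ∈ s.p.entries ∨ s.p.next ≤ e.1

theorem ProcState.Evolves.refl (s : ProcState I P) : s.Evolves s :=
  ⟨le_rfl, le_rfl, fun _ => le_rfl, le_rfl, fun _ h => Or.inl h⟩

theorem ProcState.Evolves.trans {s s' s'' : ProcState I P} (h : s.Evolves s')
    (h' : s'.Evolves s'') : s.Evolves s'' where
  uNext_le := h.uNext_le.trans h'.uNext_le
  first_le := h.first_le.trans h'.first_le
  ld_le i := (h.ld_le i).trans (h'.ld_le i)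
  next_le := h.next_le.trans h'.next_le
  entries e he := (h'.entries e he).elim (h.entries e) fun h1 => Or.inr (h.next_le.trans h1)

/-! ### Causal-sent messages -/

section Created

variable (cfg : ℕ → Config I P) (ev : ℕ → Event I P)

/-- At step `s`, process `i` causal-sends to `j` the payload `x`, in a message with id `n` and
predecessor id `pid`. -/
def CreatedAt (s : ℕ) (i j : I) (n pid : ℕ) (x : P) : Prop :=
  ev s = .causalSend i j x ∧ ((cfg s).proc i).ck = n ∧ ((cfg s).proc i).ls j = pid

/-- At some step, past or future, `i` causal-sends this message. -/
def Created (i j : I) (n pid : ℕ) (x : P) : Prop :=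
  ∃ s, CreatedAt cfg ev s i j n pid x

end Created

variable [DecidableEq I] {cfg : ℕ → Config I P} {ev : ℕ → Event I P}

theorem IsExecution.proc_succ (h : IsExecution cfg ev) (t : ℕ) :
    (cfg (t + 1)).proc (ev t).proc = ((cfg t).outcome (ev t)).state := by
  rw [h.step]; simp [Config.step]

theorem IsExecution.proc_succ_of_ne (h : IsExecution cfg ev) {t : ℕ} {i : I}
    (hi : i ≠ (ev t).proc) : (cfg (t + 1)).proc i = (cfg t).proc i := by
  rw [h.step]; simp [Config.step, hi]

theorem handle_clock (s : ProcState I P) (e : Event I P) :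
    ((e.handle s).state.ck = s.ck ∧ (e.handle s).state.ls = s.ls) ∨
      ∃ j x, e = .causalSend e.proc j x ∧ (e.handle s).state.ck = s.ck + 1 ∧
        (e.handle s).state.ls = Function.update s.ls j s.ck := by
  cases e with
  | causalSend i j x => exact Or.inr ⟨j, x, rfl, rfl, rfl⟩
  | periodic i => exact Or.inl ⟨rfl, rfl⟩
  | receive i j k =>
    left
    cases k with
    | msg m => simp only [Event.handle, onMsg]; split_ifs <;> exact ⟨rfl, rfl⟩
    | ack n => simp only [Event.handle, onAck]; split_ifs <;> exact ⟨rfl, rfl⟩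
    | permit n => exact ⟨rfl, rfl⟩

theorem handle_sb (s : ProcState I P) (e : Event I P) {m : QueuedMsg I P}
    (hm : m ∈ (e.handle s).state.sb) :
    m ∈ s.sb ∨ e = .causalSend e.proc m.rcv m.pl ∧ s.ck = m.mid ∧ s.ls m.rcv = m.pid ∧
      s.p.next = m.per := by
  cases e with
  | causalSend i j x =>
    have h := mem_sb_trySend hm
    simp only [List.mem_append, List.mem_singleton] at h
    rcases h with h | rfl
    · exact Or.inl h
    · exact Or.inr ⟨rfl, rfl, rfl, rfl⟩
  | periodic i => exact Or.inl hm
  | receive i j k =>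
    left
    cases k with
    | msg m => simp only [Event.handle, onMsg] at hm; split_ifs at hm <;> exact hm
    | ack n => simp only [Event.handle, onAck] at hm; split_ifs at hm <;> exact hm
    | permit n => exact mem_sb_trySend (s := { s with p := s.p.remove ⟨j, n⟩ }) hm

section Facts

variable (h : IsExecution cfg ev)

include h

theorem clock_succ (t : ℕ) (i : I) :
    (((cfg (t + 1)).proc i).ck = ((cfg t).proc i).ck ∧
      ((cfg (t + 1)).proc i).ls = ((cfg t).proc i).ls) ∨
    ∃ j x, ev t = .causalSend i j x ∧ ((cfg (t + 1)).proc i).ck = ((cfg t).proc i).ck + 1 ∧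
      ((cfg (t + 1)).proc i).ls = Function.update ((cfg t).proc i).ls j ((cfg t).proc i).ck := by
  rcases eq_or_ne i (ev t).proc with rfl | hi
  · rw [h.proc_succ]
    exact handle_clock _ _
  · rw [h.proc_succ_of_ne hi]
    exact Or.inl ⟨rfl, rfl⟩

theorem ck_mono (i : I) : Monotone fun t => ((cfg t).proc i).ck := by
  refine monotone_nat_of_le_succ fun t => ?_
  rcases clock_succ h t i with ⟨h1, -⟩ | ⟨j, x, -, h1, -⟩ <;> omega

theorem ls_lt_ck (t : ℕ) (i j : I) : ((cfg t).proc i).ls j < ((cfg t).proc i).ck := by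
  induction t with
  | zero => simp [h.init, Config.init, ProcState.init]
  | succ t ih =>
    rcases clock_succ h t i with ⟨h1, h2⟩ | ⟨j', x, -, h1, h2⟩ <;> rw [h1, h2]
    · exact ih
    · rw [Function.update_apply]; split_ifs <;> omega

theorem ls_eq_zero_or_created (t : ℕ) (i j : I) :
    ((cfg t).proc i).ls j = 0 ∨ ∃ pid x, Created cfg ev i j (((cfg t).proc i).ls j) pid x := by
  induction t with
  | zero => simp [h.init, Config.init, ProcState.init]
  | succ t ih =>
    rcases clock_succ h t i with ⟨-, h2⟩ | ⟨j', x, he, -, h2⟩ <;> rw [h2]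
    · exact ih
    · rcases eq_or_ne j j' with rfl | hj
      · exact Or.inr ⟨_, x, t, he, by simp, rfl⟩
      · simpa [hj] using ih

theorem ls_mono (i j : I) : Monotone fun t => ((cfg t).proc i).ls j := by
  refine monotone_nat_of_le_succ fun t => ?_
  have := ls_lt_ck h t i j
  rcases clock_succ h t i with ⟨-, h1⟩ | ⟨j', x, -, -, h1⟩ <;> rw [h1]
  rw [Function.update_apply]; split_ifs <;> omega

theorem CreatedAt.clock {s : ℕ} {i j : I} {n pid : ℕ} {x : P}
    (hc : CreatedAt cfg ev s i j n pid x) :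
    ((cfg (s + 1)).proc i).ck = n + 1 ∧ ((cfg (s + 1)).proc i).ls j = n := by
  obtain ⟨he, rfl, rfl⟩ := hc
  have hi : i = (ev s).proc := by rw [he]; rfl
  have h1 := h.proc_succ s
  rw [← hi] at h1
  rw [h1, he]
  simp [Config.outcome, Event.handle, onCausalSend, trySend, Event.proc]

theorem CreatedAt.step_lt {s : ℕ} {i j : I} {n pid : ℕ} {x : P}
    (hc : CreatedAt cfg ev s i j n pid x) {t : ℕ} (ht : n < ((cfg t).proc i).ck) : s < t := by
  by_contra hst
  have := ck_mono h i (not_lt.1 hst)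
  have := hc.2.1
  dsimp only at *
  omega

/-- An id determines the message. -/
theorem Created.unique {i j j' : I} {n pid pid' : ℕ} {x x' : P}
    (hc : Created cfg ev i j n pid x) (hc' : Created cfg ev i j' n pid' x') :
    j = j' ∧ pid = pid' ∧ x = x' := by
  obtain ⟨s, hs⟩ := hc
  obtain ⟨s', hs'⟩ := hc'
  have h1 := hs.step_lt h (t := s' + 1) (by rw [(hs'.clock h).1]; omega)
  have h2 := hs'.step_lt h (t := s + 1) (by rw [(hs.clock h).1]; omega)
  obtain rfl : s = s' := by omega
  have he := hs.1.symm.trans hs'.1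
  simp only [Event.causalSend.injEq, true_and] at he
  obtain ⟨rfl, rfl⟩ := he
  exact ⟨rfl, hs.2.2.symm.trans hs'.2.2, rfl⟩

theorem Created.pid_lt {i j : I} {n pid : ℕ} {x : P}
    (hc : Created cfg ev i j n pid x) : pid < n := by
  obtain ⟨s, -, rfl, rfl⟩ := hc
  exact ls_lt_ck h s i j

theorem Created.pid_eq_zero_or {i j : I} {n pid : ℕ} {x : P}
    (hc : Created cfg ev i j n pid x) : pid = 0 ∨ ∃ pid' x', Created cfg ev i j pid pid' x' := by
  obtain ⟨s, -, -, rfl⟩ := hc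
  exact ls_eq_zero_or_created h s i j

/-- No message from `i` to `j` has an id strictly between those of a message and its
predecessor. -/
theorem Created.le_of_pid_lt {i j : I} {n pid n' pid' : ℕ} {x x' : P}
    (hc : Created cfg ev i j n pid x) (hc' : Created cfg ev i j n' pid' x') (hn : pid < n') :
    n ≤ n' := by
  obtain ⟨s, hs⟩ := hc
  obtain ⟨s', hs'⟩ := hc'
  by_contra hlt
  have h1 : s' < s := hs'.step_lt h (by rw [hs.2.1]; omega)
  have h2 := ls_mono h i j (show s' + 1 ≤ s from h1)
  have h3 := (hs'.clock h).2
  have h4 := hs.2.2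
  dsimp only at h2
  omega

theorem sb_created (t : ℕ) (i : I) : ∀ m ∈ ((cfg t).proc i).sb,
    ∃ s, CreatedAt cfg ev s i m.rcv m.mid m.pid m.pl ∧ ((cfg s).proc i).p.next = m.per := by
  induction t with
  | zero => simp [h.init, Config.init, ProcState.init]
  | succ t ih =>
    intro m hm
    rcases eq_or_ne i (ev t).proc with rfl | hi
    · rw [h.proc_succ] at hm
      rcases handle_sb _ _ hm with h1 | ⟨h1, h2, h3, h4⟩
      · exact ih m h1
      · exact ⟨t, ⟨h1, h2, h3⟩, h4⟩
    · rw [h.proc_succ_of_ne hi] at hm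
      exact ih m hm

end Facts

/-! ### The invariant of the system -/

/-- The invariant of an execution, as a property of a configuration: everything found in buffers
and in transit comes from causal-sent messages, acks are only sent for delivered messages, and a
message that has left the send buffer stays in the unacked buffer with its payload at least until it
is delivered (`pending`). -/
structure Invariant (cfg : ℕ → Config I P) (ev : ℕ → Event I P) (c : Config I P) : Prop where
  wf : ∀ i, (c.proc i).WellFormed
  u : ∀ i, ∀ m ∈ (c.proc i).u.elems, ∀ x, m.pl = some x → Created cfg ev i m.rcv m.mid m.pid x
  rb : ∀ i j k r, ((c.proc j).rb i).lookup k = some r →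
    Created cfg ev i j r.mid k r.pl ∧ r.mid < (c.proc i).uNext
  ld_lt : ∀ i j, (c.proc j).ld i < (c.proc i).uNext
  ld_eq : ∀ i j, (c.proc j).ld i = 0 ∨ ∃ pid x, Created cfg ev i j ((c.proc j).ld i) pid x
  p : ∀ j, ∀ e ∈ (c.proc j).p.entries,
    (∃ pid x, Created cfg ev e.2.snd j e.2.mid pid x) ∧ e.2.mid ≤ (c.proc j).ld e.2.snd
  msg : ∀ i j m, (⟨i, j, .msg m⟩ : Sent I P) ∈ c.net →
    Created cfg ev i j m.mid m.pid m.pl ∧ m.mid < (c.proc i).uNext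
  ack : ∀ i j n, (⟨j, i, .ack n⟩ : Sent I P) ∈ c.net →
    (∃ pid x, Created cfg ev i j n pid x) ∧ n ≤ (c.proc j).ld i
  pending : ∀ i j n pid x, Created cfg ev i j n pid x → n < (c.proc i).uNext →
    (∃ b, (⟨j, n, pid, b, some x⟩ : UnackedMsg I P) ∈ (c.proc i).u.elems) ∨
      n ≤ (c.proc j).ld i

/-- The conditions on the outcome of an event at process `q` in configuration `c` under which the
event preserves the invariant. -/
structure Outcome.Sound (cfg : ℕ → Config I P) (ev : ℕ → Event I P) (c : Config I P) (q : I)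
    (o : Outcome I P) : Prop where
  evolves : (c.proc q).Evolves o.state
  wf : o.state.WellFormed
  u : ∀ m ∈ o.state.u.elems, ∀ x, m.pl = some x → Created cfg ev q m.rcv m.mid m.pid x
  rb : ∀ i k r, (o.state.rb i).lookup k = some r →
    Created cfg ev i q r.mid k r.pl ∧ r.mid < (c.proc i).uNext
  ld_lt : ∀ i, o.state.ld i < (c.proc i).uNext
  ld_eq : ∀ i, o.state.ld i = 0 ∨ ∃ pid x, Created cfg ev i q (o.state.ld i) pid x
  p : ∀ e ∈ o.state.p.entries,
    (∃ pid x, Created cfg ev e.2.snd q e.2.mid pid x) ∧ e.2.mid ≤ o.state.ld e.2.snd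
  msg : ∀ j m, (j, .msg m) ∈ o.sends →
    Created cfg ev q j m.mid m.pid m.pl ∧ m.mid < o.state.uNext
  ack : ∀ i n, (i, .ack n) ∈ o.sends →
    (∃ pid x, Created cfg ev i q n pid x) ∧ n ≤ o.state.ld i
  pending : ∀ j n pid x, Created cfg ev q j n pid x → n < o.state.uNext →
    (∃ b, (⟨j, n, pid, b, some x⟩ : UnackedMsg I P) ∈ o.state.u.elems) ∨
      n ≤ (c.proc j).ld q

theorem Invariant.init (h : IsExecution cfg ev) : Invariant cfg ev (Config.init I P) where
  wf i := ⟨le_rfl, by simp [Config.init, ProcState.init], by simp [Config.init, ProcState.init],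
    by simp [Config.init, ProcState.init]⟩
  u := by simp [Config.init, ProcState.init]
  rb := by simp [Config.init, ProcState.init]
  ld_lt := by simp [Config.init, ProcState.init, ProcState.uNext]
  ld_eq := by simp [Config.init, ProcState.init]
  p := by simp [Config.init, ProcState.init]
  msg := by simp [Config.init]
  ack := by simp [Config.init]
  pending i j n pid x hc hn := by
    have := hc.pid_lt h
    simp only [Config.init, ProcState.init, ProcState.uNext, List.length_nil] at hn
    omega

theorem Outcome.Sound.evolves_step {c : Config I P} {e : Event I P}
    (ho : (c.outcome e).Sound cfg ev c e.proc) (i : I) :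
    (c.proc i).Evolves ((c.step e).proc i) := by
  rcases eq_or_ne i e.proc with rfl | hi
  · simpa [Config.step] using ho.evolves
  · simpa [Config.step, hi] using ProcState.Evolves.refl _

theorem Invariant.step {c : Config I P} (hc : Invariant cfg ev c) {e : Event I P}
    (ho : (c.outcome e).Sound cfg ev c e.proc) : Invariant cfg ev (c.step e) := by
  have hev := ho.evolves_step
  have hq : (c.step e).proc e.proc = (c.outcome e).state := by simp [Config.step]
  have hne : ∀ i, i ≠ e.proc → (c.step e).proc i = c.proc i := fun i hi => by
    simp [Config.step, hi]
  have hnet : ∀ w, w ∈ (c.step e).net →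
      w ∈ c.net ∨ w.src = e.proc ∧ (w.dst, w.body) ∈ (c.outcome e).sends := fun w hw => hw
  constructor
  · intro i
    rcases eq_or_ne i e.proc with rfl | hi
    · rw [hq]; exact ho.wf
    · rw [hne i hi]; exact hc.wf i
  · intro i
    rcases eq_or_ne i e.proc with rfl | hi
    · rw [hq]; exact ho.u
    · rw [hne i hi]; exact hc.u i
  · intro i j k r hr
    have key : Created cfg ev i j r.mid k r.pl ∧ r.mid < (c.proc i).uNext := by
      rcases eq_or_ne j e.proc with rfl | hj
      · rw [hq] at hr; exact ho.rb i k r hr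
      · rw [hne j hj] at hr; exact hc.rb i j k r hr
    exact ⟨key.1, key.2.trans_le (hev i).uNext_le⟩
  · intro i j
    refine lt_of_lt_of_le ?_ (hev i).uNext_le
    rcases eq_or_ne j e.proc with rfl | hj
    · rw [hq]; exact ho.ld_lt i
    · rw [hne j hj]; exact hc.ld_lt i j
  · intro i j
    rcases eq_or_ne j e.proc with rfl | hj
    · rw [hq]; exact ho.ld_eq i
    · rw [hne j hj]; exact hc.ld_eq i j
  · intro j
    rcases eq_or_ne j e.proc with rfl | hj
    · rw [hq]; exact ho.p
    · rw [hne j hj]; exact hc.p j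
  · intro i j m hm
    rcases hnet _ hm with h1 | ⟨rfl, h1⟩
    · obtain ⟨h2, h3⟩ := hc.msg i j m h1
      exact ⟨h2, h3.trans_le (hev i).uNext_le⟩
    · rw [hq]; exact ho.msg j m h1
  · intro i j n hn
    rcases hnet _ hn with h1 | ⟨rfl, h1⟩
    · obtain ⟨h2, h3⟩ := hc.ack i j n h1
      exact ⟨h2, h3.trans ((hev j).ld_le i)⟩
    · rw [hq]; exact ho.ack i n h1
  · intro i j n pid x h1 h2
    have key : (∃ b, (⟨j, n, pid, b, some x⟩ : UnackedMsg I P) ∈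
        ((c.step e).proc i).u.elems) ∨ n ≤ (c.proc j).ld i := by
      rcases eq_or_ne i e.proc with rfl | hi
      · rw [hq] at h2 ⊢; exact ho.pending j n pid x h1 h2
      · rw [hne i hi] at h2 ⊢; exact hc.pending i j n pid x h1 h2
    exact key.imp_right fun h3 => h3.trans ((hev j).ld_le i)

/-- `trySend` preserves the invariant also when it is run after permits have been removed and
messages have been put into the send buffer. -/
theorem Invariant.sound_trySend (h : IsExecution cfg ev) {c : Config I P}
    (hc : Invariant cfg ev c) (q : I) {s : ProcState I P} (hu : s.u = (c.proc q).u)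
    (hld : s.ld = (c.proc q).ld) (hrb : s.rb = (c.proc q).rb)
    (hnext : s.p.next = (c.proc q).p.next)
    (hp : ∀ e ∈ s.p.entries, e ∈ (c.proc q).p.entries) (hle : s.u.first ≤ s.ck)
    (hids : s.u.elems.map Msg.mid ++ s.sb.map Msg.mid = List.range' s.u.first (s.ck - s.u.first))
    (hsb : ∀ m ∈ s.sb, Created cfg ev q m.rcv m.mid m.pid m.pl) :
    (trySend s).Sound cfg ev c q := by
  have hsent := fun n => trySend_sent hids (n := n)
  obtain ⟨vs, sb', he, hs, hbl⟩ := trySend_spec s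
  rw [he] at hsent ⊢
  have hmem : ∀ v ∈ vs, v.1 ∈ s.sb := fun v hv => by
    rw [hs]; exact List.mem_append_left _ (List.mem_map_of_mem hv)
  have hids' : (s.u.elems ++ vs.map fun v => v.1.toUnacked v.2).map Msg.mid ++
      sb'.map Msg.mid = List.range' s.u.first (s.ck - s.u.first) := by
    rw [← hids, hs]
    simp [Msg.toUnacked, Function.comp_def]
  have huNext : s.uNext = (c.proc q).uNext := by simp only [ProcState.uNext, hu]
  constructor
  · refine ⟨?_, (congrArg _ hu).ge, fun i => (congrFun hld i).ge, hnext.ge,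
      fun e he => Or.inl (hp e he)⟩
    rw [← huNext]
    simp only [ProcState.uNext, List.length_append]
    omega
  · refine ⟨hle, hids', ?_, hbl⟩
    intro m hm
    dsimp only at hm
    rw [List.head?_append] at hm
    cases hh : s.u.elems.head? with
    | some m' =>
      rw [hh] at hm
      simp only [Option.some_or, Option.mem_def, Option.some.injEq] at hm
      subst hm
      exact (hc.wf q).head m' (by rw [← hu]; exact hh)
    | none =>
      rw [hh] at hm
      simp only [Option.none_or] at hm
      obtain ⟨v, -, rfl⟩ := List.mem_map.1 (List.mem_of_mem_head? hm)
      simp [Msg.toUnacked]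
  · intro m hm x hx
    rcases List.mem_append.1 hm with hm | hm
    · exact hc.u q m (hu ▸ hm) x hx
    · obtain ⟨v, hv, rfl⟩ := List.mem_map.1 hm
      simp only [Msg.toUnacked, Option.some.injEq] at hx ⊢
      subst hx
      exact hsb _ (hmem v hv)
  · intro i k r hr
    dsimp only at hr
    rw [hrb] at hr
    exact hc.rb i q k r hr
  · intro i
    dsimp only
    rw [hld]
    exact hc.ld_lt i q
  · intro i
    dsimp only
    rw [hld]
    exact hc.ld_eq i q
  · intro e he
    dsimp only
    rw [hld]
    exact hc.p q e (hp e he)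
  · intro j m hm
    obtain ⟨v, hv, h1⟩ := List.mem_map.1 hm
    simp only [Prod.mk.injEq, Packet.msg.injEq] at h1
    obtain ⟨rfl, rfl⟩ := h1
    refine ⟨hsb _ (hmem v hv), ?_⟩
    exact (mid_lt_uNext (m := v.1.toUnacked v.2) hids'
      (List.mem_append_right _ (List.mem_map.2 ⟨v, hv, rfl⟩))).2
  · intro i n hn
    obtain ⟨v, hv, h1⟩ := List.mem_map.1 hn
    simp at h1
  · intro j n pid x h1 h2
    rcases lt_or_ge n s.uNext with h3 | h3
    · rcases hc.pending q j n pid x h1 (huNext ▸ h3) with ⟨b, h4⟩ | h4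
      · exact Or.inl ⟨b, List.mem_append_left _ (hu ▸ h4)⟩
      · exact Or.inr h4
    · obtain ⟨m, hm, b, rfl, h4, -⟩ := hsent n h3 h2
      obtain ⟨rfl, rfl, rfl⟩ := h1.unique h (hsb m hm)
      exact Or.inl ⟨b, h4⟩

theorem Invariant.sound_onCausalSend (h : IsExecution cfg ev) {c : Config I P}
    (hc : Invariant cfg ev c) (q j : I) (x : P)
    (hsb : ∀ m ∈ (c.proc q).sb, Created cfg ev q m.rcv m.mid m.pid m.pl)
    (hnew : Created cfg ev q j (c.proc q).ck ((c.proc q).ls j) x) :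
    (onCausalSend (c.proc q) j x).Sound cfg ev c q := by
  refine hc.sound_trySend h q rfl rfl rfl rfl (fun e he => he)
    (Nat.le_succ_of_le (hc.wf q).first_le) ?_ ?_
  · exact (hc.wf q).ids_push j _ _ x
  · intro m hm
    rcases List.mem_append.1 hm with hm | hm
    · exact hsb m hm
    · rw [List.mem_singleton.1 hm]
      exact hnew

theorem Invariant.sound_onPermit (h : IsExecution cfg ev) {c : Config I P}
    (hc : Invariant cfg ev c) (q j : I) (n : ℕ)
    (hsb : ∀ m ∈ (c.proc q).sb, Created cfg ev q m.rcv m.mid m.pid m.pl) :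
    (onPermit (c.proc q) j n).Sound cfg ev c q :=
  hc.sound_trySend h q rfl rfl rfl rfl (fun _ he => (List.mem_filter.1 he).1) (hc.wf q).first_le
    (hc.wf q).ids hsb

omit [DecidableEq I] in
theorem Invariant.sound_onPeriodic {c : Config I P} (hc : Invariant cfg ev c) (q : I) :
    (onPeriodic (c.proc q)).Sound cfg ev c q where
  evolves := .refl _
  wf := hc.wf q
  u := hc.u q
  rb i := hc.rb i q
  ld_lt i := hc.ld_lt i q
  ld_eq i := hc.ld_eq i q
  p := hc.p q
  msg j m hm := by
    simp only [onPeriodic, List.mem_append, List.mem_filterMap, List.mem_map,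
      Option.map_eq_some_iff, Prod.mk.injEq, reduceCtorEq, and_false, exists_false, or_false,
      Packet.msg.injEq] at hm
    obtain ⟨m', hm', x, hx, rfl, rfl⟩ := hm
    exact ⟨hc.u q m' hm' x hx, (mid_lt_uNext (hc.wf q).ids hm').2⟩
  ack i n hn := by
    simp only [onPeriodic, List.mem_append, List.mem_filterMap, List.mem_map,
      Option.map_eq_some_iff, Prod.mk.injEq, reduceCtorEq, and_false, exists_false, false_or,
      Packet.ack.injEq] at hn
    obtain ⟨e, he, rfl, rfl⟩ := hn
    exact hc.p q e he
  pending := hc.pending q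

omit [DecidableEq I] in
theorem Invariant.lt_uNext_of_ack {c : Config I P} (hc : Invariant cfg ev c) {q j : I} {n : ℕ}
    (hn : (⟨j, q, .ack n⟩ : Sent I P) ∈ c.net) : n < (c.proc q).uNext :=
  (hc.ack q j n hn).2.trans_lt (hc.ld_lt q j)

theorem Invariant.sound_onAck (h : IsExecution cfg ev) {c : Config I P}
    (hc : Invariant cfg ev c) (q j : I) (n : ℕ) (hn : (⟨j, q, .ack n⟩ : Sent I P) ∈ c.net) :
    (onAck (c.proc q) j n).Sound cfg ev c q := by
  obtain ⟨⟨pid, x, hcr⟩, hnld⟩ := hc.ack q j n hn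
  obtain ⟨u', d, h1, h2, h3, h4, h5, -, h6⟩ := onAck_spec (hc.wf q) j (hc.lt_uNext_of_ack hn)
  have hlen := congrArg List.length h2
  simp only [List.length_map, List.length_append] at hlen
  have hids := congrArg (List.map Msg.mid) h2
  rw [List.map_map, show (Msg.mid ∘ ackIf n : UnackedMsg I P → ℕ) = Msg.mid from
    funext (ackIf_mid n), List.map_append] at hids
  -- The remaining ids are the old ones without the first `d.length` of them.
  have hids' : u'.elems.map Msg.mid ++ (c.proc q).sb.map Msg.mid =
      List.range' u'.first ((c.proc q).ck - u'.first) := by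
    have h7 := congrArg (List.drop d.length) (hc.wf q).ids
    rw [hids, List.append_assoc, List.drop_left' (by simp), List.drop_range'] at h7
    rw [h7, h3, mul_one, Nat.sub_sub]
  have huN : u'.first + u'.elems.length = (c.proc q).uNext := by
    unfold ProcState.uNext; omega
  have hmem : ∀ m ∈ (c.proc q).u.elems, ackIf n m ∈ d ∨ ackIf n m ∈ u'.elems := fun m hm =>
    List.mem_append.1 (h2 ▸ List.mem_map_of_mem hm)
  constructor
  · rw [h1]
    exact ⟨huN.ge, by simp [h3], fun _ => le_rfl, le_rfl, fun _ => Or.inl⟩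
  · rw [h1]
    refine ⟨?_, hids', h5, (hc.wf q).blocked⟩
    have := uNext_add_length (hc.wf q).first_le (hc.wf q).ids
    simp only
    omega
  · rw [h1]
    intro m hm x hx
    have hm' : m ∈ (c.proc q).u.elems.map (ackIf n) := h2 ▸ List.mem_append_right _ hm
    obtain ⟨m', hmem', rfl⟩ := List.mem_map.1 hm'
    have hm'' := eq_of_ackIf_pl_eq_some hx
    rw [hm''] at hx ⊢
    exact hc.u q m' hmem' x hx
  · rw [h1]; exact fun i => hc.rb i q
  · rw [h1]; exact fun i => hc.ld_lt i q
  · rw [h1]; exact fun i => hc.ld_eq i q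
  · rw [h1]; exact hc.p q
  · intro i m hm
    obtain ⟨k, hk⟩ := h6 _ hm
    simp at hk
  · intro i m hm
    obtain ⟨k, hk⟩ := h6 _ hm
    simp at hk
  · intro j' n' pid' x' hcr' hn'
    rw [h1] at hn' ⊢
    rcases hc.pending q j' n' pid' x' hcr' (huN ▸ hn') with ⟨b, hb⟩ | hb
    · by_cases hnn : n' = n
      · subst hnn
        obtain ⟨rfl, -⟩ := hcr.unique h hcr'
        exact Or.inr hnld
      · left
        refine ⟨b, ?_⟩
        have h7 := hmem _ hb
        rw [ackIf_of_ne hnn] at h7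
        exact h7.resolve_left fun h8 => by simpa using h4 _ h8
    · exact Or.inr hb

/-- The records that may be stored in the receive buffer of `q` for the sender `j`. -/
def Genuine (cfg : ℕ → Config I P) (ev : ℕ → Event I P) (c : Config I P) (j q : I) (k : ℕ)
    (r : Rcv P) : Prop :=
  Created cfg ev j q r.mid k r.pl ∧ r.mid < (c.proc j).uNext

theorem Invariant.deliverSpec (h : IsExecution cfg ev) {c : Config I P}
    (hc : Invariant cfg ev c) {q j : I} {m : WireMsg I P}
    (hm : (⟨j, q, .msg m⟩ : Sent I P) ∈ c.net) :
    DeliverSpec j (Genuine cfg ev c j q)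
      (((c.proc q).rb j).insert m.pid ⟨m.mid, m.pl, m.per⟩) ((c.proc q).ld j) (c.proc q).p
      (deliverLoop j (((c.proc q).rb j).insert m.pid ⟨m.mid, m.pl, m.per⟩) ((c.proc q).ld j)
        (c.proc q).p) := by
  refine deliverLoop_spec j (fun k r hr => hr.1.pid_lt h) _ _ _ fun k b hb => ?_
  by_cases hk : k = m.pid
  · subst hk
    rw [AList.lookup_insert] at hb
    obtain rfl := Option.some.inj hb
    exact hc.msg j q m hm
  · rw [AList.lookup_insert_ne hk] at hb
    exact hc.rb j q k b hb

theorem Invariant.sound_onMsg (h : IsExecution cfg ev) {c : Config I P}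
    (hc : Invariant cfg ev c) (q j : I) (m : WireMsg I P)
    (hm : (⟨j, q, .msg m⟩ : Sent I P) ∈ c.net) :
    (onMsg (c.proc q) j m).Sound cfg ev c q := by
  have hcr := hc.msg j q m hm
  unfold onMsg
  split_ifs with hle
  · refine ⟨.refl _, hc.wf q, hc.u q, fun i => hc.rb i q, fun i => hc.ld_lt i q,
      fun i => hc.ld_eq i q, hc.p q, by simp, ?_, hc.pending q⟩
    intro i n hn
    simp only [List.mem_singleton, Prod.mk.injEq, Packet.ack.injEq] at hn
    obtain ⟨rfl, rfl⟩ := hn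
    exact ⟨⟨_, _, hcr.1⟩, hle⟩
  · have hd := hc.deliverSpec h hm
    set r := deliverLoop j (((c.proc q).rb j).insert m.pid ⟨m.mid, m.pl, m.per⟩)
      ((c.proc q).ld j) (c.proc q).p
    have hld : ∀ i, (c.proc q).ld i ≤ Function.update (c.proc q).ld j r.ld i := by
      intro i
      rw [Function.update_apply]
      split_ifs with hi
      · exact hi ▸ hd.ld_le
      · exact le_rfl
    constructor
    · exact ⟨le_rfl, le_rfl, hld, hd.next_le, fun e he => (hd.entries e he).imp_right And.left⟩
    · refine ⟨(hc.wf q).first_le, (hc.wf q).ids, (hc.wf q).head, fun m hm => ?_⟩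
      exact hd.first_eq.trans_lt ((hc.wf q).blocked m hm)
    · exact hc.u q
    · intro i k b hb
      rcases eq_or_ne i j with rfl | hi
      · simp only [Function.update_self] at hb
        exact hd.rb k b hb
      · simp only [Function.update_of_ne hi] at hb
        exact hc.rb i q k b hb
    · intro i
      rcases eq_or_ne i j with rfl | hi
      · simp only [Function.update_self]
        rcases hd.ld_eq with h1 | ⟨k, b, h1, h2⟩
        · rw [h1]; exact hc.ld_lt i q
        · rw [← h2]; exact h1.2
      · simp only [Function.update_of_ne hi]
        exact hc.ld_lt i q
    · intro i
      rcases eq_or_ne i j with rfl | hi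
      · simp only [Function.update_self]
        rcases hd.ld_eq with h1 | ⟨k, b, h1, h2⟩
        · rw [h1]; exact hc.ld_eq i q
        · rw [← h2]; exact Or.inr ⟨_, _, h1.1⟩
      · simp only [Function.update_of_ne hi]
        exact hc.ld_eq i q
    · intro e he
      rcases hd.entries e he with h1 | ⟨-, k, b, h1, h2, h3⟩
      · obtain ⟨h4, h5⟩ := hc.p q e h1
        exact ⟨h4, h5.trans (hld _)⟩
      · rw [h2]
        exact ⟨⟨_, _, h1.1⟩, by simpa using h3⟩
    · intro i m' hm'
      obtain ⟨k, b, -, h1, -⟩ := hd.sends _ hm'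
      simp at h1
    · intro i n hn
      obtain ⟨k, b, h1, h2, h3⟩ := hd.sends _ hn
      simp only [Prod.mk.injEq, Packet.ack.injEq] at h2
      obtain ⟨rfl, rfl⟩ := h2
      exact ⟨⟨_, _, h1.1⟩, by simpa using h3⟩
    · exact hc.pending q

/-- In an execution, the outcome of every event that happens in a configuration satisfying the
invariant is sound. -/
theorem Invariant.sound (h : IsExecution cfg ev) {t : ℕ} (hc : Invariant cfg ev (cfg t)) :
    ((cfg t).outcome (ev t)).Sound cfg ev (cfg t) (ev t).proc := by
  have hen := h.enabled t
  have hsb : ∀ i, ∀ m ∈ ((cfg t).proc i).sb, Created cfg ev i m.rcv m.mid m.pid m.pl :=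
    fun i m hm => (sb_created h t i m hm).imp fun _ => And.left
  cases he : ev t with
  | causalSend i j x => exact hc.sound_onCausalSend h i j x (hsb i) ⟨t, he, rfl, rfl⟩
  | periodic i => exact hc.sound_onPeriodic i
  | receive i j k =>
    rw [he] at hen
    cases k with
    | msg m => exact hc.sound_onMsg h i j m hen
    | ack n => exact hc.sound_onAck h i j n hen
    | permit n => exact hc.sound_onPermit h i j n (hsb i)

theorem invariant (h : IsExecution cfg ev) (t : ℕ) : Invariant cfg ev (cfg t) := by
  induction t with
  | zero => rw [h.init]; exact .init h
  | succ t ih => rw [h.step]; exact ih.step (ih.sound h)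

theorem evolves (h : IsExecution cfg ev) (i : I) {t t' : ℕ} (ht : t ≤ t') :
    ((cfg t).proc i).Evolves ((cfg t').proc i) := by
  induction t', ht using Nat.le_induction with
  | base => exact .refl _
  | succ t' _ ih =>
    rw [h.step]
    exact ih.trans (((invariant h t').sound h).evolves_step i)

open Filter

/-! ### Progress in one step -/

theorem exists_crossing {p : ℕ → Prop} {a b : ℕ} (hab : a ≤ b) (ha : ¬ p a) (hb : p b) :
    ∃ s, a ≤ s ∧ ¬ p s ∧ p (s + 1) := by
  induction b, hab using Nat.le_induction with
  | base => exact absurd hb ha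
  | succ b hab ih =>
    by_cases h : p b
    · exact ih h
    · exact ⟨b, hab, h, hb⟩

theorem IsExecution.proc_succ_of_eq (h : IsExecution cfg ev) {t : ℕ} {e : Event I P}
    (he : ev t = e) :
    (cfg (t + 1)).proc e.proc = (e.handle ((cfg t).proc e.proc)).state := by
  subst he; exact h.proc_succ t

/-- A message with id `n` is delivered at the step at which the id of the last delivered message
reaches `n`: as ids skip no message, that step cannot jump over `n`. -/
theorem delivers_of_ld (h : IsExecution cfg ev) {t : ℕ} {i j : I} {n pid : ℕ} {x : P}
    (hc : Created cfg ev i j n pid x) (h1 : ((cfg t).proc j).ld i < n)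
    (h2 : n ≤ ((cfg (t + 1)).proc j).ld i) : Delivers cfg ev t j i n x := by
  have hne : ((cfg (t + 1)).proc j).ld i ≠ ((cfg t).proc j).ld i := by omega
  have hj : j = (ev t).proc := by
    by_contra hj
    exact hne (by rw [h.proc_succ_of_ne hj])
  refine ⟨hj.symm, ?_⟩
  have hen := h.enabled t
  have hs := h.proc_succ t
  rw [← hj] at hs
  rw [hs] at h2 hne
  unfold Config.outcome at h2 hne ⊢
  rw [← hj] at h2 hne ⊢
  cases he : ev t with
  | causalSend i' j' x' => rw [he] at hne; exact absurd rfl hne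
  | periodic i' => rw [he] at hne; exact absurd rfl hne
  | receive i' j' k =>
    rw [he] at h2 hne hen hj
    obtain rfl : j = i' := hj
    cases k with
    | ack m =>
      simp only [Event.handle, onAck] at hne
      split_ifs at hne <;> exact absurd rfl hne
    | permit m => exact absurd rfl hne
    | msg m =>
      simp only [Event.handle, onMsg] at h2 hne ⊢
      split_ifs at h2 hne ⊢ with hle
      · exact absurd rfl hne
      · obtain rfl : i = j' := by
          by_contra hi
          exact hne (by simp [hi])
        simp only [Function.update_self] at h2
        obtain ⟨k, b, g1, g2, g3, g4⟩ := ((invariant h t).deliverSpec h hen).delivered n h1 h2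
        obtain rfl : n = b.mid := g3.antisymm (g1.1.le_of_pid_lt h hc g2)
        obtain ⟨-, -, rfl⟩ := hc.unique h g1.1
        exact g4

/-- On receipt of a message whose predecessor has been delivered, the message is delivered, unless
that has happened before. -/
theorem le_ld_of_receive (h : IsExecution cfg ev) {t : ℕ} {i j : I} {m : WireMsg I P}
    (he : ev t = .receive j i (.msg m)) (hpid : m.pid ≤ ((cfg t).proc j).ld i) :
    m.mid ≤ ((cfg (t + 1)).proc j).ld i := by
  by_cases hle : m.mid ≤ ((cfg t).proc j).ld i
  · exact hle.trans ((evolves h j t.le_succ).ld_le i)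
  have hen := h.enabled t
  rw [he] at hen
  have hinv := invariant h t
  have hld : ((cfg t).proc j).ld i = m.pid := by
    rcases hinv.ld_eq i j with h1 | ⟨pid, x, h1⟩
    · omega
    · by_contra hne
      exact hle ((hinv.msg i j m hen).1.le_of_pid_lt h h1 (by omega))
  have hs : (cfg (t + 1)).proc j = (onMsg ((cfg t).proc j) i m).state := h.proc_succ_of_eq he
  rw [hs, onMsg, if_neg hle]
  simp only [Function.update_self]
  exact (hinv.deliverSpec h hen).progress ⟨m.mid, m.pl, m.per⟩ (by rw [hld, AList.lookup_insert])

/-- When the end of the unacked buffer of `i` passes `n`, the message with id `n` is network-sent,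
and nothing is delivered at `i`. -/
theorem exists_sent_of_uNext (h : IsExecution cfg ev) {t : ℕ} {i : I} {n : ℕ}
    (h1 : ((cfg t).proc i).uNext ≤ n) (h2 : n < ((cfg (t + 1)).proc i).uNext) :
    (∃ j, ∃ m : WireMsg I P, m.mid = n ∧ (⟨i, j, .msg m⟩ : Sent I P) ∈ (cfg t).sentBy (ev t)) ∧
      (ev t).proc = i ∧ ((cfg (t + 1)).proc i).ld = ((cfg t).proc i).ld := by
  have hi : i = (ev t).proc := by
    by_contra hi
    rw [h.proc_succ_of_ne hi] at h2
    omega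
  have hen := h.enabled t
  have hs := h.proc_succ t
  have hwf := (invariant h t).wf i
  simp only [Config.sentBy, Set.mem_ofPred_eq, ← hi, true_and]
  rw [← hi] at hs
  unfold Config.outcome at hs ⊢
  rw [← hi] at hs ⊢
  rw [hs] at h2 ⊢
  cases he : ev t with
  | causalSend i' j x =>
    rw [he] at h2
    obtain ⟨m, -, b, h3, -, h4⟩ := trySend_sent
      (s := { (cfg t).proc i with
        ls := Function.update ((cfg t).proc i).ls j ((cfg t).proc i).ck
        ck := ((cfg t).proc i).ck + 1
        sb := ((cfg t).proc i).sb ++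
          [⟨j, ((cfg t).proc i).ck, ((cfg t).proc i).ls j, ((cfg t).proc i).p.next, x⟩] })
      (hwf.ids_push j _ _ x) h1 h2
    exact ⟨⟨_, _, h3, h4⟩, rfl⟩
  | periodic i' =>
    rw [he] at h2
    exact absurd h2 h1.not_gt
  | receive i' j k =>
    rw [he] at h2 hen hi
    obtain rfl : i = i' := hi
    cases k with
    | msg m =>
      simp only [Event.handle, onMsg] at h2
      split_ifs at h2 <;> exact absurd h2 h1.not_gt
    | ack m =>
      obtain ⟨u', d, g1, g2, g3, -⟩ := onAck_spec hwf j ((invariant h t).lt_uNext_of_ack hen)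
      have hlen := congrArg List.length g2
      simp only [List.length_map, List.length_append] at hlen
      simp only [Event.handle, g1, ProcState.uNext] at h1 h2
      omega
    | permit m =>
      obtain ⟨m, -, b, h3, -, h4⟩ := trySend_sent
        (s := { (cfg t).proc i with p := ((cfg t).proc i).p.remove ⟨j, m⟩ }) hwf.ids h1 h2
      exact ⟨⟨_, _, h3, h4⟩, rfl⟩

/-! ### Liveness -/

omit [DecidableEq I] in
theorem PeriodicFair.frequently (hper : PeriodicFair ev) {t : ℕ} {i : I} (ht : (ev t).proc = i) :
    ∃ᶠ s in atTop, ev s = .periodic i :=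
  frequently_atTop.2 (hper i ⟨t, ht⟩)

theorem FairLossy.frequently (hfair : FairLossy cfg ev) {i j : I} {k : Packet I P}
    (hs : ∃ᶠ s in atTop, (⟨i, j, k⟩ : Sent I P) ∈ (cfg s).sentBy (ev s)) :
    ∃ᶠ s in atTop, ev s = .receive j i k :=
  frequently_atTop.2 (hfair i j k (frequently_atTop.1 hs))

omit [DecidableEq I] in
theorem Created.frequently_periodic (hper : PeriodicFair ev) {i j : I} {n pid : ℕ} {x : P}
    (hc : Created cfg ev i j n pid x) : ∃ᶠ s in atTop, ev s = .periodic i := by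
  obtain ⟨s, hs, -⟩ := hc
  exact hper.frequently (t := s) (by rw [hs]; rfl)

/-- A message that stays unacked is received again and again. The permit flag, of which the
hypothesis says nothing, takes one of its two values infinitely often. -/
theorem frequently_receive_of_unacked (hper : PeriodicFair ev) (hfair : FairLossy cfg ev)
    {i j : I} {n pid : ℕ} {x : P} (hc : Created cfg ev i j n pid x)
    (hu : ∀ᶠ s in atTop, ∃ b,
      (⟨j, n, pid, b, some x⟩ : UnackedMsg I P) ∈ ((cfg s).proc i).u.elems) :
    ∃ b, ∃ᶠ s in atTop, ev s = .receive j i (.msg ⟨j, n, pid, b, x⟩) := by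
  have h1 : ∃ᶠ s in atTop, ∃ b : Bool,
      (⟨i, j, .msg ⟨j, n, pid, b, x⟩⟩ : Sent I P) ∈ (cfg s).sentBy (ev s) := by
    refine ((hc.frequently_periodic hper).and_eventually hu).mono ?_
    rintro s ⟨he, b, hb⟩
    refine ⟨b, ?_⟩
    rw [he]
    refine ⟨rfl, List.mem_append_left _ (List.mem_filterMap.2 ⟨_, hb, rfl⟩)⟩
  simp only [Bool.exists_bool] at h1 ⊢
  exact (frequently_or_distrib.1 h1).imp hfair.frequently hfair.frequently

/-- Every network-sent message is eventually delivered, by induction on its id: once its predecessor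
has been delivered, so is the message when it is received again. -/
theorem exists_le_ld (h : IsExecution cfg ev) (hper : PeriodicFair ev) (hfair : FairLossy cfg ev)
    {i j : I} {n pid : ℕ} {x : P} (hc : Created cfg ev i j n pid x) {t : ℕ}
    (hn : n < ((cfg t).proc i).uNext) : ∃ t', n ≤ ((cfg t').proc j).ld i := by
  induction n using Nat.strong_induction_on generalizing pid x with
  | _ n ih =>
  have hlt := hc.pid_lt h
  obtain ⟨t₁, ht₁⟩ : ∃ t₁, pid ≤ ((cfg t₁).proc j).ld i := by
    rcases hc.pid_eq_zero_or h with rfl | ⟨pid', x', hc'⟩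
    · exact ⟨0, Nat.zero_le _⟩
    · exact ih pid hlt hc' (hlt.trans hn)
  by_contra! hno
  have hu : ∀ᶠ s in atTop, ∃ b,
      (⟨j, n, pid, b, some x⟩ : UnackedMsg I P) ∈ ((cfg s).proc i).u.elems := by
    filter_upwards [eventually_ge_atTop t] with s hs
    exact ((invariant h s).pending i j n pid x hc
      (hn.trans_le (evolves h i hs).uNext_le)).resolve_right (hno s).not_ge
  obtain ⟨b, hb⟩ := frequently_receive_of_unacked hper hfair hc hu
  obtain ⟨r, hr, her⟩ := frequently_atTop.1 hb t₁
  exact (hno (r + 1)).not_ge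
    (le_ld_of_receive h her (ht₁.trans ((evolves h j hr).ld_le i)))

/-- No message stays unacked: after its delivery, each of its receipts is answered by an ack. -/
theorem not_eventually_unacked (h : IsExecution cfg ev) (hper : PeriodicFair ev)
    (hfair : FairLossy cfg ev) {i j : I} {n pid : ℕ} {x : P} (hc : Created cfg ev i j n pid x) :
    ¬ ∀ᶠ s in atTop, ∃ b,
      (⟨j, n, pid, b, some x⟩ : UnackedMsg I P) ∈ ((cfg s).proc i).u.elems := by
  intro hu
  obtain ⟨t, ht⟩ := hu.exists
  have hn : n < ((cfg t).proc i).uNext := by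
    obtain ⟨b, hb⟩ := ht
    exact (mid_lt_uNext ((invariant h t).wf i).ids hb).2
  obtain ⟨t', ht'⟩ := exists_le_ld h hper hfair hc hn
  obtain ⟨b, hb⟩ := frequently_receive_of_unacked hper hfair hc hu
  have hack : ∃ᶠ s in atTop, (⟨j, i, .ack n⟩ : Sent I P) ∈ (cfg s).sentBy (ev s) := by
    refine (hb.and_eventually (eventually_ge_atTop t')).mono ?_
    rintro s ⟨he, hs⟩
    rw [he]
    refine ⟨rfl, ?_⟩
    simp [Config.outcome, Event.handle, Event.proc, onMsg,
      ht'.trans ((evolves h j hs).ld_le i)]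
  have hu' := (tendsto_add_atTop_nat 1).eventually hu
  obtain ⟨s, he, b', hb'⟩ := ((hfair.frequently hack).and_eventually hu').exists
  have hen := h.enabled s
  rw [he] at hen
  obtain ⟨u', d, h1, h2, -⟩ :=
    onAck_spec ((invariant h s).wf i) j ((invariant h s).lt_uNext_of_ack hen)
  have hs := (h.proc_succ_of_eq he).trans h1
  simp only [Event.proc] at hs
  rw [hs] at hb'
  have hm : _ ∈ ((cfg s).proc i).u.elems.map (ackIf n) := h2 ▸ List.mem_append_right _ hb'
  obtain ⟨m, -, hm⟩ := List.mem_map.1 hm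
  have hmid : m.mid = n := by rw [← ackIf_mid n m, hm]
  have := ackIf_pl_of_eq hmid
  simp [hm] at this

/-- The start of the unacked buffer passes the id of every network-sent message, since the oldest
entry of the buffer is never an acked one. -/
theorem exists_lt_first (h : IsExecution cfg ev) (hper : PeriodicFair ev) (hfair : FairLossy cfg ev)
    {i : I} {n t : ℕ} (hn : n < ((cfg t).proc i).uNext) : ∃ t', n < ((cfg t').proc i).u.first := by
  suffices hf : ∀ f ≤ n + 1, ∃ t' ≥ t, f ≤ ((cfg t').proc i).u.first by
    obtain ⟨t', -, ht'⟩ := hf (n + 1) le_rfl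
    exact ⟨t', ht'⟩
  intro f hfn
  induction f with
  | zero => exact ⟨t, le_rfl, Nat.zero_le _⟩
  | succ f ih =>
    obtain ⟨t', htt', ht'⟩ := ih (by omega)
    by_contra! hno
    have hold : ∀ s ≥ t', ∃ j pid b x,
        (⟨j, f, pid, b, some x⟩ : UnackedMsg I P) ∈ ((cfg s).proc i).u.elems := by
      intro s hs
      have h1 := (evolves h i hs).first_le
      have h2 := hno s (htt'.trans hs)
      have h3 := (evolves h i (htt'.trans hs)).uNext_le
      have h4 : ((cfg s).proc i).u.first = f := by omega
      have h5 := ((invariant h s).wf i).exists_oldest (by omega)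
      rwa [h4] at h5
    obtain ⟨j, pid, b, x, hm⟩ := hold t' le_rfl
    have hc := (invariant h t').u i _ hm x rfl
    refine not_eventually_unacked h hper hfair hc ?_
    filter_upwards [eventually_ge_atTop t'] with s hs
    obtain ⟨j', pid', b', x', hm'⟩ := hold s hs
    obtain ⟨rfl, rfl, rfl⟩ := hc.unique h ((invariant h s).u i _ hm' x' rfl)
    exact ⟨b', hm'⟩

/-- No permit stays missing: the ack that asks for it is sent again and again, and from some time on
is answered by the permit. -/
theorem not_eventually_missing (h : IsExecution cfg ev) (hper : PeriodicFair ev)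
    (hfair : FairLossy cfg ev) {i : I} (hi : ∃ᶠ s in atTop, ev s = .periodic i) (e : ℕ × Per I) :
    ¬ ∀ᶠ s in atTop, e ∈ ((cfg s).proc i).p.entries := by
  intro he
  obtain ⟨k, j, n⟩ := e
  obtain ⟨t, ht⟩ := he.exists
  have hn : n < ((cfg t).proc j).uNext :=
    ((invariant h t).p i _ ht).2.trans_lt ((invariant h t).ld_lt j i)
  obtain ⟨t', ht'⟩ := exists_lt_first h hper hfair hn
  have hack : ∃ᶠ s in atTop, (⟨i, j, .ack n⟩ : Sent I P) ∈ (cfg s).sentBy (ev s) := by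
    refine (hi.and_eventually he).mono ?_
    rintro s ⟨hev, hs⟩
    rw [hev]
    exact ⟨rfl, List.mem_append_right _ (List.mem_map.2 ⟨_, hs, rfl⟩)⟩
  have hpermit : ∃ᶠ s in atTop, (⟨j, i, .permit n⟩ : Sent I P) ∈ (cfg s).sentBy (ev s) := by
    refine ((hfair.frequently hack).and_eventually (eventually_ge_atTop t')).mono ?_
    rintro s ⟨hev, hs⟩
    rw [hev]
    refine ⟨rfl, ?_⟩
    simp [Config.outcome, Event.handle, Event.proc, onAck,
      ht'.trans_le (evolves h j hs).first_le]
  have he' := (tendsto_add_atTop_nat 1).eventually he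
  obtain ⟨s, hev, hs⟩ := ((hfair.frequently hpermit).and_eventually he').exists
  have hs' := h.proc_succ_of_eq hev
  simp only [Event.proc] at hs'
  rw [hs'] at hs
  simpa using (List.mem_filter.1 hs).2

/-- All permits missing at step `t` eventually arrive. -/
theorem eventually_next_le_first (h : IsExecution cfg ev) (hper : PeriodicFair ev)
    (hfair : FairLossy cfg ev) {i : I} (hi : ∃ᶠ s in atTop, ev s = .periodic i) (t : ℕ) :
    ∀ᶠ s in atTop, ((cfg t).proc i).p.next ≤ ((cfg s).proc i).p.first := by
  have hgone : ∀ e ∈ {e | e ∈ ((cfg t).proc i).p.entries}, ∀ᶠ s in atTop,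
      e.1 < ((cfg t).proc i).p.next → e ∉ ((cfg s).proc i).p.entries := by
    intro e _
    obtain ⟨s₀, hs₀, hes₀⟩ := frequently_atTop.1
      (not_eventually.1 (not_eventually_missing h hper hfair hi e)) t
    filter_upwards [eventually_ge_atTop s₀] with s hs hlt hes
    -- An entry that has gone does not come back, as new entries get new indices.
    rcases (evolves h i hs).entries e hes with h1 | h1
    · exact hes₀ h1
    · have := (evolves h i hs₀).next_le
      omega
  filter_upwards [(eventually_all_finite (List.finite_toSet _)).2 hgone, eventually_ge_atTop t]
    with s hs hts
  unfold SlidingMap.first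
  split
  · exact (evolves h i hts).next_le
  · next e l he =>
    by_contra hlt
    have hes : e ∈ ((cfg s).proc i).p.entries := by rw [he]; exact List.mem_cons_self
    rcases (evolves h i hts).entries e hes with h1 | h1
    · exact hs e h1 (not_le.1 hlt) hes
    · exact hlt h1

/-- Every message leaves the send buffer: the oldest message waits only for permits that were
missing when it was put there. -/
theorem exists_lt_uNext (h : IsExecution cfg ev) (hper : PeriodicFair ev) (hfair : FairLossy cfg ev)
    {i : I} (hi : ∃ᶠ s in atTop, ev s = .periodic i) {n t : ℕ} (hn : n < ((cfg t).proc i).ck) :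
    ∃ t' ≥ t, n < ((cfg t').proc i).uNext := by
  by_contra! hno
  obtain ⟨s, hs, hts⟩ := ((eventually_next_le_first h hper hfair hi t).and
    (eventually_ge_atTop t)).exists
  have hwf := (invariant h s).wf i
  have h1 := uNext_add_length hwf.first_le hwf.ids
  have h2 := ck_mono h i hts
  have h3 := hno s hts
  dsimp only at h2
  cases hsb : ((cfg s).proc i).sb with
  | nil =>
    rw [hsb, List.length_nil] at h1
    omega
  | cons m l =>
    have hmid : m.mid = ((cfg s).proc i).uNext + 0 := mid_of_getElem?_sb hwf.ids (by simp [hsb])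
    obtain ⟨c, hc, hper'⟩ := sb_created h s i m (by simp [hsb])
    have hct : c < t := hc.step_lt h (by omega)
    have h4 := (evolves h i hct.le).next_le
    have h5 := hwf.blocked m (by simp [hsb])
    omega

end CausalDelivery

theorem mainTheorem3 {I : Type*} {P : Type*} [DecidableEq I]
    (cfg : ℕ → CausalDelivery.Config I P) (ev : ℕ → CausalDelivery.Event I P)
    (hexec : CausalDelivery.IsExecution cfg ev)
    (hperiodic : CausalDelivery.PeriodicFair ev)
    (hfair : CausalDelivery.FairLossy cfg ev)
    (t : ℕ) (i j : I) (x : P) (hsend : ev t = .causalSend i j x) :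
    ∃ s ≥ t,
      CausalDelivery.NetworkSends cfg ev s i j ((cfg t).proc i).ck x ∧
      (∀ r > s, ∀ m ∈ ((cfg r).proc i).sb, m.mid ≠ ((cfg t).proc i).ck) ∧
      ∃ d > s, CausalDelivery.Delivers cfg ev d j i ((cfg t).proc i).ck x := by
  have hat : CausalDelivery.CreatedAt cfg ev t i j ((cfg t).proc i).ck (((cfg t).proc i).ls j) x :=
    ⟨hsend, rfl, rfl⟩
  have hc : CausalDelivery.Created cfg ev i j ((cfg t).proc i).ck (((cfg t).proc i).ls j) x :=
    ⟨t, hat⟩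
  have hck := (hat.clock hexec).1
  have hwf := (CausalDelivery.invariant hexec t).wf i
  have hle := CausalDelivery.uNext_add_length hwf.first_le hwf.ids
  generalize ((cfg t).proc i).ck = n at *
  obtain ⟨t', htt', ht'⟩ := CausalDelivery.exists_lt_uNext hexec hperiodic hfair
    (hc.frequently_periodic hperiodic) (n := n) (t := t + 1) (by omega)
  obtain ⟨s, hts, hs, hs'⟩ := CausalDelivery.exists_crossing
    (p := fun r => n < ((cfg r).proc i).uNext) (by omega : t ≤ t') (by omega) ht'
  obtain ⟨⟨j', m, hm, hsent⟩, hproc, hld⟩ :=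
    CausalDelivery.exists_sent_of_uNext hexec (not_lt.1 hs) hs'
  refine ⟨s, hts, ⟨m, hm, ?_⟩, ?_, ?_⟩
  · have hnet : (⟨i, j', .msg m⟩ : CausalDelivery.Sent I P) ∈ (cfg (s + 1)).net := by
      rw [hexec.step]
      exact Or.inr hsent
    have hc' := ((CausalDelivery.invariant hexec (s + 1)).msg i j' m hnet).1
    rw [hm] at hc'
    obtain ⟨rfl, -, rfl⟩ := hc.unique hexec hc'
    exact ⟨rfl, hsent⟩
  · intro r hr q hq
    have h1 := CausalDelivery.uNext_le_mid ((CausalDelivery.invariant hexec r).wf i).ids hq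
    have h2 := (CausalDelivery.evolves hexec i (show s + 1 ≤ r from hr)).uNext_le
    omega
  · -- The message is not delivered up to step `s`, as `i` has not network-sent it before.
    have hld' : ((cfg (s + 1)).proc j).ld i < n := by
      have h1 := (CausalDelivery.invariant hexec s).ld_lt i j
      have h2 : ((cfg (s + 1)).proc j).ld i = ((cfg s).proc j).ld i := by
        rcases eq_or_ne j i with rfl | hj
        · rw [hld]
        · rw [hexec.proc_succ_of_ne (hproc ▸ hj)]
      omega
    obtain ⟨d, hd⟩ := CausalDelivery.exists_le_ld hexec hperiodic hfair hc hs'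
    have hsd : s + 1 ≤ d := by
      by_contra hlt
      have := (CausalDelivery.evolves hexec j (not_le.1 hlt).le).ld_le i
      omega
    obtain ⟨d', h1, h2, h3⟩ := CausalDelivery.exists_crossing
      (p := fun r => n ≤ ((cfg r).proc j).ld i) hsd (by omega) hd
    exact ⟨d', h1, CausalDelivery.delivers_of_ld hexec hc (not_le.1 h2) h3⟩
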